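/- Let $\mathbb D^d=\{z\in\mathbb C^d: |z_i|<1,\ i=1,\dots,d\}$. For complex Hilbert spaces $\mathcal U,\mathcal V$, the Schur--Agler class $\mathcal{SA}_d(\mathcal U,\mathcal V)$ consists of the analytic functions $f(z)=\sum_{r\in\mathbb N_0^d} f_r z^r$ on $\mathbb D^d$, with values in the bounded operators $\mathcal L(\mathcal U,\mathcal V)$, such that for every $d$-tuple $T=(T_1,\dots,T_d)$ of commuting strict contractions ($\|T_i\|<1$) on a Hilbert space $\mathcal H$ the operator $f(T)=\sum_{r} f_r\otimes T^r:\mathcal U\otimes\mathcal H\to\mathcal V\otimes\mathcal H$ satisfies $\|f(T)\|\le 1$. Here $\otimes$ is the Hilbert space tensor product. Let $\mathcal U^{\otimes k}$ be the $k$-fold tensor power of $\mathcal U$, and let $\mathcal U^{\wedge k}\subseteq\mathcal U^{\otimes k}$ be the closed subspace generated by the elementary antisymmetric tensors $u_1\wedge\cdots\wedge u_k=\sum_{\sigma}\operatorname{sign}(\sigma)\,u_{\sigma(1)}\otimes\cdots\otimes u_{\sigma(k)}$, where $\sigma$ runs over the permutations of $1,\dots,k$. **Theorem.** Let $\mathcal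 U$ and $\mathcal V$ be Hilbert spaces and let $S_1,\dots,S_k\in\mathcal{SA}_d(\mathcal U,\mathcal V)$. Then the function $S_1\otimes\cdots\otimes S_k$, $z\mapsto S_1(z)\otimes\cdots\otimes S_k(z)$, belongs to $\mathcal{SA}_d(\mathcal U^{\otimes k},\mathcal V^{\otimes k})$, and its compression $S_1\wedge\cdots\wedge S_k$, $z\mapsto \pi_{\mathcal V^{\wedge k}}\big(S_1(z)\otimes\cdots\otimes S_k(z)\big)\big|_{\mathcal U^{\wedge k}}$, where $\pi_{\mathcal V^{\wedge k}}$ is the orthogonal projection of $\mathcal V^{\otimes k}$ onto $\mathcal V^{\wedge k}$, belongs to $\mathcal{SA}_d(\mathcal U^{\wedge k},\mathcal V^{\wedge k})$. **Corollary.** Let $S$ be an $n\times n$ matrix-valued Schur--Agler function, i.e. $S\in\mathcal{SA}_d(\mathbb C^n,\mathbb C^n)$ with $\mathbb C^n$ Euclidean. Then for every $k=1,\dots,n$ the $k$-th compound matrix-valued function of $S$, i.e. the $\binom nk\times\binom nk$ matrix whose entries are the minors $\det S(z)[I,J]$ for $k$-element subsets $I,J\subseteq\{1,\dots,n\}$,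 is also Schur--Agler. In particular, the scalar function $\det S(z)$ is Schur--Agler, i.e. belongs to $\mathcal{SA}_d(\mathbb C,\mathbb C)$. -/

import Mathlib

open scoped TensorProduct InnerProductSpace

universe u v w

noncomputable section

/-! ### Hilbert space tensor products -/

/-- The Hilbert space tensor product `E ⊗ F`: the completion of the algebraic tensor product for
the inner product with `⟪x ⊗ y, x' ⊗ y'⟫ = ⟪x, x'⟫ * ⟪y, y'⟫`. -/
abbrev HilbertTensor (E : Type u) (F : Type v)
    [NormedAddCommGroup E] [InnerProductSpace ℂ E]
    [NormedAddCommGroup F] [InnerProductSpace ℂ F] : Type (max u v) :=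
  UniformSpace.Completion (E ⊗[ℂ] F)

/-- The elementary tensor `x ⊗ y` in the Hilbert space tensor product. -/
def HilbertTensor.mk {E : Type u} {F : Type v}
    [NormedAddCommGroup E] [InnerProductSpace ℂ E]
    [NormedAddCommGroup F] [InnerProductSpace ℂ F] (x : E) (y : F) : HilbertTensor E F :=
  ((x ⊗ₜ[ℂ] y : E ⊗[ℂ] F) : UniformSpace.Completion (E ⊗[ℂ] F))

/-- The bounded operator `A ⊗ B` between Hilbert space tensor products, the continuous extension
of `x ⊗ y ↦ A x ⊗ B y`. -/
def HilbertTensor.map {E E' F F' : Type*}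
    [NormedAddCommGroup E] [InnerProductSpace ℂ E]
    [NormedAddCommGroup E'] [InnerProductSpace ℂ E']
    [NormedAddCommGroup F] [InnerProductSpace ℂ F]
    [NormedAddCommGroup F'] [InnerProductSpace ℂ F']
    (A : E →L[ℂ] E') (B : F →L[ℂ] F') : HilbertTensor E F →L[ℂ] HilbertTensor E' F' :=
  (TensorProduct.mapL A B).completion

/-! ### The Schur–Agler class -/

/-- The open unit polydisk in `ℂ^d`. -/
def polydisk (d : ℕ) : Set (Fin d → ℂ) := {z | ∀ i, ‖z i‖ < 1}

/-- The monomial `T^r = T_1^{r_1} ⋯ T_d^{r_d}` in a tuple of operators. -/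
def opMonomial {d : ℕ} {H : Type*} [NormedAddCommGroup H] [InnerProductSpace ℂ H]
    (T : Fin d → H →L[ℂ] H) (r : Fin d → ℕ) : H →L[ℂ] H :=
  (List.ofFn fun i => T i ^ r i).prod

/-- `c` is the family of power series coefficients of `f` on the polydisk:
`f z = ∑ r, z^r c_r` for every `z` in the polydisk. -/
def HasPolydiskExpansion {d : ℕ} {E : Type*} [NormedAddCommGroup E] [NormedSpace ℂ E]
    (c : (Fin d → ℕ) → E) (f : (Fin d → ℂ) → E) : Prop :=
  ∀ z ∈ polydisk d, HasSum (fun r : Fin d → ℕ => (∏ i, z i ^ r i) • c r) (f z)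

/-- The Schur–Agler class `SA_d(U, V)`: analytic `L(U, V)`-valued functions `f = ∑ r, c_r z^r` on
the polydisk such that `f(T) = ∑ r, c_r ⊗ T^r`, an operator from `U ⊗ H` to `V ⊗ H`, satisfies
`‖f(T)‖ ≤ 1` for every `d`-tuple `T` of commuting strict contractions on a Hilbert space `H`.
(The coefficients `c_r` are determined by `f`; the values of `f` off the polydisk play no role.) -/
def IsSchurAgler {d : ℕ} {U : Type u} {V : Type v}
    [NormedAddCommGroup U] [InnerProductSpace ℂ U]
    [NormedAddCommGroup V] [InnerProductSpace ℂ V]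
    (f : (Fin d → ℂ) → U →L[ℂ] V) : Prop :=
  AnalyticOnNhd ℂ f (polydisk d) ∧
  ∃ c : (Fin d → ℕ) → U →L[ℂ] V, HasPolydiskExpansion c f ∧
    ∀ (H : Type w) [NormedAddCommGroup H] [InnerProductSpace ℂ H] [CompleteSpace H]
      (T : Fin d → H →L[ℂ] H), (∀ i j, Commute (T i) (T j)) → (∀ i, ‖T i‖ < 1) →
      ∃ fT : HilbertTensor U H →L[ℂ] HilbertTensor V H,
        HasSum (fun r : Fin d → ℕ => HilbertTensor.map (c r) (opMonomial T r)) fT ∧ ‖fT‖ ≤ 1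

/-! ### Tensor powers -/

/-- A complex Hilbert space, bundled, so that the tensor powers can be defined by recursion. -/
structure BundledHilbert : Type (u + 1) where
  carrier : Type u
  [normed : NormedAddCommGroup carrier]
  [inner : InnerProductSpace ℂ carrier]
  [complete : CompleteSpace carrier]

/-- The tensor powers of `U`, bundled: `U^{⊗0}` is the one-dimensional space `ℂ` (in the universe
of `U`), and `U^{⊗(k+1)} = U^{⊗k} ⊗ U`. -/
def bundledTensorPower (U : Type u) [NormedAddCommGroup U] [InnerProductSpace ℂ U] :
    ℕ → BundledHilbert.{u}
  | 0 => ⟨EuclideanSpace ℂ PUnit.{u + 1}⟩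
  | k + 1 =>
    letI := (bundledTensorPower U k).normed
    letI := (bundledTensorPower U k).inner
    ⟨HilbertTensor (bundledTensorPower U k).carrier U⟩

/-- The `k`-fold Hilbert space tensor power `U^{⊗k}`. -/
def TensorPow (k : ℕ) (U : Type u) [NormedAddCommGroup U] [InnerProductSpace ℂ U] : Type u :=
  (bundledTensorPower U k).carrier

instance (k : ℕ) (U : Type u) [NormedAddCommGroup U] [InnerProductSpace ℂ U] :
    NormedAddCommGroup (TensorPow k U) := (bundledTensorPower U k).normed

instance (k : ℕ) (U : Type u) [NormedAddCommGroup U] [InnerProductSpace ℂ U] :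
    InnerProductSpace ℂ (TensorPow k U) := (bundledTensorPower U k).inner

instance (k : ℕ) (U : Type u) [NormedAddCommGroup U] [InnerProductSpace ℂ U] :
    CompleteSpace (TensorPow k U) := (bundledTensorPower U k).complete

/-- The elementary tensor `v_1 ⊗ ⋯ ⊗ v_k` in `U^{⊗k}`. -/
def TensorPow.tprod {U : Type u} [NormedAddCommGroup U] [InnerProductSpace ℂ U] :
    (k : ℕ) → (Fin k → U) → TensorPow k U
  | 0, _ => (EuclideanSpace.single PUnit.unit 1 : EuclideanSpace ℂ PUnit.{u + 1})
  | k + 1, x =>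
    (HilbertTensor.mk (TensorPow.tprod k fun i => x i.castSucc) (x (Fin.last k)) :
      HilbertTensor (TensorPow k U) U)

/-- The bounded operator `A_1 ⊗ ⋯ ⊗ A_k : U^{⊗k} → V^{⊗k}`. For `k = 0` it is the identity of `ℂ`
(between the copies of `ℂ` in the two universes). -/
def TensorPow.map {U : Type u} {V : Type v}
    [NormedAddCommGroup U] [InnerProductSpace ℂ U]
    [NormedAddCommGroup V] [InnerProductSpace ℂ V] :
    (k : ℕ) → (Fin k → U →L[ℂ] V) → (TensorPow k U →L[ℂ] TensorPow k V)
  | 0, _ =>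
    ((LinearIsometryEquiv.piLpCongrLeft 2 ℂ ℂ
      (Equiv.punitEquivPUnit : PUnit.{u + 1} ≃ PUnit.{v + 1}) :
        EuclideanSpace ℂ PUnit.{u + 1} ≃ₗᵢ[ℂ] EuclideanSpace ℂ PUnit.{v + 1}) :
      EuclideanSpace ℂ PUnit.{u + 1} →L[ℂ] EuclideanSpace ℂ PUnit.{v + 1})
  | k + 1, A =>
    (HilbertTensor.map (TensorPow.map k fun i => A i.castSucc) (A (Fin.last k)) :
      HilbertTensor (TensorPow k U) U →L[ℂ] HilbertTensor (TensorPow k V) V)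

/-! ### Antisymmetric tensor powers -/

/-- The elementary antisymmetric tensor
`v_1 ∧ ⋯ ∧ v_k = ∑ σ, sign(σ) v_{σ(1)} ⊗ ⋯ ⊗ v_{σ(k)}` in `U^{⊗k}`. -/
def TensorPow.wedge {U : Type u} [NormedAddCommGroup U] [InnerProductSpace ℂ U]
    (k : ℕ) (x : Fin k → U) : TensorPow k U :=
  ∑ σ : Equiv.Perm (Fin k), ((Equiv.Perm.sign σ : ℤ) : ℂ) • TensorPow.tprod k fun i => x (σ i)

/-- The antisymmetric tensor power `U^{∧k}`: the closed subspace of `U^{⊗k}` generated by the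
elementary antisymmetric tensors. -/
abbrev WedgePow (k : ℕ) (U : Type u) [NormedAddCommGroup U] [InnerProductSpace ℂ U] :
    Submodule ℂ (TensorPow k U) :=
  (Submodule.span ℂ (Set.range (TensorPow.wedge (U := U) k))).topologicalClosure

/-- The function `S_1 ⊗ ⋯ ⊗ S_k`, `z ↦ S_1(z) ⊗ ⋯ ⊗ S_k(z)`. -/
def tensorFun {d k : ℕ} {U : Type u} {V : Type v}
    [NormedAddCommGroup U] [InnerProductSpace ℂ U]
    [NormedAddCommGroup V] [InnerProductSpace ℂ V]
    (S : Fin k → (Fin d → ℂ) → U →L[ℂ] V) (z : Fin d → ℂ) :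
    TensorPow k U →L[ℂ] TensorPow k V :=
  TensorPow.map k fun j => S j z

/-- The function `S_1 ∧ ⋯ ∧ S_k`, the compression of `S_1 ⊗ ⋯ ⊗ S_k` to the antisymmetric
subspaces: restriction to `U^{∧k}` followed by the orthogonal projection onto `V^{∧k}`. -/
def wedgeFun {d k : ℕ} {U : Type u} {V : Type v}
    [NormedAddCommGroup U] [InnerProductSpace ℂ U]
    [NormedAddCommGroup V] [InnerProductSpace ℂ V]
    (S : Fin k → (Fin d → ℂ) → U →L[ℂ] V) (z : Fin d → ℂ) :
    WedgePow k U →L[ℂ] WedgePow k V :=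
  (WedgePow k V).orthogonalProjectionOnto ∘L tensorFun S z ∘L (WedgePow k U).subtypeL

/-! ### Compound matrices -/

/-- The `k`-th compound matrix of `M`: rows and columns are indexed by the `k`-element subsets
`I`, `J` of the index set, listed increasingly, and the entries are the minors `det M[I, J]`. -/
def compoundMatrix {n : ℕ} (k : ℕ) (M : Matrix (Fin n) (Fin n) ℂ) :
    Matrix {s : Finset (Fin n) // s.card = k} {s : Finset (Fin n) // s.card = k} ℂ :=
  Matrix.of fun I J => (M.submatrix (I.1.orderEmbOfFin I.2) (J.1.orderEmbOfFin J.2)).det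

/-- A matrix-valued function is Schur–Agler if the corresponding function with values in the
operators on the Euclidean space `ℂ^ι` is. -/
def IsMatrixSchurAgler {d : ℕ} {ι : Type*} [Fintype ι] [DecidableEq ι]
    (F : (Fin d → ℂ) → Matrix ι ι ℂ) : Prop :=
  IsSchurAgler.{_, _, w} fun z =>
    (Matrix.toEuclideanCLM (n := ι) (𝕜 := ℂ) (F z) : EuclideanSpace ℂ ι →L[ℂ] EuclideanSpace ℂ ι)

/-- A scalar function `g` is Schur–Agler if it is so as a function with values in `L(ℂ, ℂ)`, the
scalar `g z` acting by multiplication. -/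
def IsScalarSchurAgler {d : ℕ} (g : (Fin d → ℂ) → ℂ) : Prop :=
  IsSchurAgler.{_, _, w} fun z => g z • ContinuousLinearMap.id ℂ ℂ

end

/-! ### Summation lemmas -/

/-! For two Schur–Agler functions `f = ∑ a_r z^r` and `g = ∑ b_s z^s`, commutativity of `T` gives
`(f ⊗ g)(T) = ∑ a_r ⊗ b_s ⊗ T^s T^r`. Up to reordering tensor factors this is `f(T) ⊗ 1` on `U₁ ⊗ H
⊗ U₂` followed by `g(T) ⊗ 1` on `U₂ ⊗ H ⊗ V₁`, a composition of contractions
(`exists_amplification`, `IsSchurAgler.tensor`). Induction on `k` gives `S_1 ⊗ ⋯ ⊗ S_k`. Multiplying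
on both sides by fixed contractions preserves the class (`IsSchurAgler.compress`), which gives the
antisymmetric compression.

The corollary rests on the Gram formula `inner_wedge`: the normalized antisymmetric tensors of basis
vectors are orthonormal, and the matrix coefficients of `S ⊗ ⋯ ⊗ S` between them are the minors of
`S`. Compound matrices and the determinant are therefore compressions of a tensor power. -/

theorem HasSum.bilinear {ι κ E F G : Type*}
    [NormedAddCommGroup E] [NormedSpace ℂ E] [NormedAddCommGroup F] [NormedSpace ℂ F]
    [NormedAddCommGroup G] [NormedSpace ℂ G] [CompleteSpace G]
    (L : E →L[ℂ] F →L[ℂ] G) {f : ι → E} {g : κ → F} {a : E} {b : F}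
    (hf : HasSum f a) (hg : HasSum g b)
    (hf' : Summable fun i => ‖f i‖) (hg' : Summable fun j => ‖g j‖) :
    HasSum (fun p : ι × κ => L (f p.1) (g p.2)) (L a b) := by
  have hs : Summable fun p : ι × κ => L (f p.1) (g p.2) := by
    refine Summable.of_norm_bounded
      (g := fun p : ι × κ => ‖L‖ * (‖f p.1‖ * ‖g p.2‖)) ?_ fun p => ?_
    · exact (hf'.mul_of_nonneg hg' (fun _ => norm_nonneg _) fun _ => norm_nonneg _).mul_left _
    · rw [← mul_assoc]; exact L.le_opNorm₂ _ _
  -- Summing over `j` first identifies the double sum: its iterated sum is also `L a b`.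
  have h1 : HasSum (fun i => L (f i) b) (∑' p : ι × κ, L (f p.1) (g p.2)) :=
    hs.hasSum.prod_fiberwise fun i => (L (f i)).hasSum hg
  have h2 : HasSum (fun i => L (f i) b) (L a b) := (L.flip b).hasSum hf
  rw [← h1.unique h2]
  exact hs.hasSum

theorem summable_prod_pow : ∀ {d : ℕ} {q : Fin d → ℝ}, (∀ i, 0 ≤ q i) → (∀ i, q i < 1) →
    Summable fun r : Fin d → ℕ => ∏ i, q i ^ r i
  | 0, _, _, _ => Summable.of_finite
  | d + 1, q, h0, h1 => by
    rw [← (Fin.consEquiv fun _ : Fin (d + 1) => ℕ).summable_iff]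
    have h := (summable_geometric_of_lt_one (h0 0) (h1 0)).mul_of_nonneg
      (summable_prod_pow (fun i => h0 (Fin.succ i)) fun i => h1 (Fin.succ i))
      (fun n => pow_nonneg (h0 0) n)
      fun r => Finset.prod_nonneg fun i _ => pow_nonneg (h0 i.succ) _
    refine h.congr fun p => ?_
    simp [Fin.consEquiv, Fin.prod_univ_succ]

/-- Abel's lemma: convergence at the midpoint radii `(1 + ρ i) / 2`, strictly between `ρ i` and `1`,
bounds the terms there, and the remaining ratios are below `1`, so a geometric series dominates. -/
theorem HasPolydiskExpansion.summable_norm {d : ℕ} {E : Type*} [NormedAddCommGroup E]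
    [NormedSpace ℂ E] {c : (Fin d → ℕ) → E} {f : (Fin d → ℂ) → E}
    (h : HasPolydiskExpansion c f) {ρ : Fin d → ℝ} (h0 : ∀ i, 0 ≤ ρ i) (h1 : ∀ i, ρ i < 1) :
    Summable fun r => ‖c r‖ * ∏ i, ρ i ^ r i := by
  have hm0 : ∀ i, 0 < (1 + ρ i) / 2 := fun i => by linarith [h0 i]
  have hm1 : ∀ i, (1 + ρ i) / 2 < 1 := fun i => by linarith [h1 i]
  have hs := (h (fun i => (((1 + ρ i) / 2 : ℝ) : ℂ)) fun i => by
    rw [Complex.norm_real, Real.norm_of_nonneg (hm0 i).le]; exact hm1 i).summable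
  obtain ⟨C, hC⟩ := hs.tendsto_cofinite_zero.norm.bddAbove_range_of_cofinite
  have hC' : ∀ r : Fin d → ℕ, (∏ i, ((1 + ρ i) / 2) ^ r i) * ‖c r‖ ≤ C := fun r => by
    have := hC ⟨r, rfl⟩
    simp only [norm_smul, norm_prod, norm_pow, Complex.norm_real,
      Real.norm_of_nonneg (hm0 _).le] at this
    exact this
  refine Summable.of_nonneg_of_le
    (fun r => mul_nonneg (norm_nonneg _) (Finset.prod_nonneg fun i _ => pow_nonneg (h0 i) _))
    (fun r => ?_) ((summable_prod_pow (q := fun i => ρ i / ((1 + ρ i) / 2))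
      (fun i => div_nonneg (h0 i) (hm0 i).le)
      fun i => by rw [div_lt_one (hm0 i)]; linarith [h1 i]).mul_left C)
  have hp : 0 < ∏ i, ((1 + ρ i) / 2) ^ r i := Finset.prod_pos fun i _ => pow_pos (hm0 i) _
  simp only [div_pow (ρ _), Finset.prod_div_distrib]
  rw [← mul_div_assoc, le_div_iff₀ hp]
  calc ‖c r‖ * (∏ i, ρ i ^ r i) * ∏ i, ((1 + ρ i) / 2) ^ r i
      = ((∏ i, ((1 + ρ i) / 2) ^ r i) * ‖c r‖) * ∏ i, ρ i ^ r i := by ring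
    _ ≤ C * ∏ i, ρ i ^ r i :=
      mul_le_mul_of_nonneg_right (hC' r) (Finset.prod_nonneg fun i _ => pow_nonneg (h0 i) _)

/-! ### Monomials in commuting operators -/

section opMonomial

variable {H : Type*} [NormedAddCommGroup H] [InnerProductSpace ℂ H]

theorem opMonomial_succ {d : ℕ} (T : Fin (d + 1) → H →L[ℂ] H) (r : Fin (d + 1) → ℕ) :
    opMonomial T r = T 0 ^ r 0 * opMonomial (fun i => T i.succ) fun i => r i.succ := by
  simp [opMonomial, List.ofFn_succ]

theorem opMonomial_zero {d : ℕ} (T : Fin d → H →L[ℂ] H) : opMonomial T 0 = 1 := by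
  simp [opMonomial]

/-- The induction moves `T 0 ^ s 0` past the monomial in the remaining operators; this is where
commutativity is needed. -/
theorem opMonomial_add : ∀ {d : ℕ} {T : Fin d → H →L[ℂ] H}, (∀ i j, Commute (T i) (T j)) →
    ∀ r s : Fin d → ℕ, opMonomial T (r + s) = opMonomial T r * opMonomial T s
  | 0, _, _, _, _ => by simp [opMonomial]
  | d + 1, T, hT, r, s => by
    have hc : Commute (opMonomial (fun i => T (Fin.succ i)) fun i => r i.succ) (T 0 ^ s 0) := by
      refine Commute.list_prod_left _ _ fun x hx => ?_
      obtain ⟨i, rfl⟩ := List.mem_ofFn.1 hx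
      exact (hT _ _).pow_pow _ _
    have ih := opMonomial_add (T := fun i => T (Fin.succ i)) (fun i j => hT _ _)
      (fun i => r i.succ) fun i => s i.succ
    rw [opMonomial_succ, opMonomial_succ T r, opMonomial_succ T s]
    change T 0 ^ (r 0 + s 0) *
      opMonomial (fun i => T (Fin.succ i)) ((fun i => r (Fin.succ i)) + fun i => s (Fin.succ i)) = _
    rw [ih, pow_add, mul_assoc, mul_assoc, ← mul_assoc (T 0 ^ s 0), ← hc.eq, mul_assoc]

theorem norm_opMonomial_le : ∀ {d : ℕ} (T : Fin d → H →L[ℂ] H) (r : Fin d → ℕ),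
    ‖opMonomial T r‖ ≤ ∏ i, ‖T i‖ ^ r i
  | 0, _, _ => by
    simp only [opMonomial, List.ofFn_zero, List.prod_nil, Fin.prod_univ_zero]
    exact ContinuousLinearMap.norm_id_le
  | d + 1, T, r => by
    rw [opMonomial_succ, Fin.prod_univ_succ]
    refine (norm_mul_le _ _).trans (mul_le_mul ?_ (norm_opMonomial_le _ _) (norm_nonneg _)
      (by positivity))
    -- Exponent `0` is separate because the identity has norm `0`, not `1`, on the zero space.
    rcases Nat.eq_zero_or_pos (r 0) with h | h
    · rw [h, pow_zero, pow_zero]; exact ContinuousLinearMap.norm_id_le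
    · exact norm_pow_le' _ h

end opMonomial

/-! ### Composition of operators -/

section OperatorComposition

variable {X X' Y Z : Type*} [NormedAddCommGroup X] [NormedSpace ℂ X]
  [NormedAddCommGroup X'] [NormedSpace ℂ X'] [NormedAddCommGroup Y] [NormedSpace ℂ Y]
  [NormedAddCommGroup Z] [NormedSpace ℂ Z]

/-- The continuous linear map `A ↦ W ∘ A ∘ W'` on operators. -/
noncomputable def sandwichL (W : Y →L[ℂ] Z) (W' : X →L[ℂ] X') :
    (X' →L[ℂ] Y) →L[ℂ] (X →L[ℂ] Z) :=
  (ContinuousLinearMap.compL ℂ X Y Z W).comp ((ContinuousLinearMap.compL ℂ X X' Y).flip W')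

theorem norm_sandwichL_apply_le {W : Y →L[ℂ] Z} {W' : X →L[ℂ] X'} {A : X' →L[ℂ] Y}
    (hW : ‖W‖ ≤ 1) (hW' : ‖W'‖ ≤ 1) (hA : ‖A‖ ≤ 1) : ‖sandwichL W W' A‖ ≤ 1 :=
  (ContinuousLinearMap.opNorm_comp_le _ _).trans (mul_le_one₀ hW (norm_nonneg _)
    ((ContinuousLinearMap.opNorm_comp_le _ _).trans (mul_le_one₀ hA (norm_nonneg _) hW')))

variable {𝒜 ℬ 𝒞 : Type*} [NormedAddCommGroup 𝒜] [NormedSpace ℂ 𝒜]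
  [NormedAddCommGroup ℬ] [NormedSpace ℂ ℬ] [NormedAddCommGroup 𝒞] [NormedSpace ℂ 𝒞]

/-! ### Cauchy products over multi-indices. -/

theorem finite_add_fiber {d : ℕ} (t : Fin d → ℕ) :
    {p : (Fin d → ℕ) × (Fin d → ℕ) | p.1 + p.2 = t}.Finite := by
  refine ((Set.finite_Iic t).prod (Set.finite_Iic t)).subset ?_
  rintro ⟨r, s⟩ h
  have h : r + s = t := h
  exact ⟨fun i => h ▸ Nat.le_add_right _ _, fun i => h ▸ Nat.le_add_left _ _⟩

/-- The pairs of multi-indices with sum `t`. -/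
noncomputable def addPairs {d : ℕ} (t : Fin d → ℕ) : Finset ((Fin d → ℕ) × (Fin d → ℕ)) :=
  (finite_add_fiber t).toFinset

theorem mem_addPairs {d : ℕ} {t : Fin d → ℕ} {p : (Fin d → ℕ) × (Fin d → ℕ)} :
    p ∈ addPairs t ↔ p.1 + p.2 = t := by
  simp [addPairs]

theorem HasSum.sum_addPairs {d : ℕ} {X : Type*} [NormedAddCommGroup X] [CompleteSpace X]
    {φ : (Fin d → ℕ) × (Fin d → ℕ) → X} {a : X}
    (h : HasSum φ a) : HasSum (fun t => ∑ p ∈ addPairs t, φ p) a := by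
  refine (h.tsum_fiberwise fun p => p.1 + p.2).congr_fun fun t => ?_
  have hS : ((fun p : (Fin d → ℕ) × (Fin d → ℕ) => p.1 + p.2) ⁻¹' {t}) =
      (addPairs t : Set ((Fin d → ℕ) × (Fin d → ℕ))) := by
    ext p
    simp [mem_addPairs]
  rw [hS]
  exact (Finset.tsum_subtype' (addPairs t) φ).symm

/-- The product of two summable operator families, with contractive connecting maps. -/
theorem exists_hasSum_sandwich {d : ℕ} {M₁ N₁ M₂ N₂ : Type*}
    [NormedAddCommGroup M₁] [NormedSpace ℂ M₁] [NormedAddCommGroup N₁] [NormedSpace ℂ N₁]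
    [NormedAddCommGroup M₂] [NormedSpace ℂ M₂] [NormedAddCommGroup N₂] [NormedSpace ℂ N₂]
    [CompleteSpace Z] {W₁ : X →L[ℂ] M₁} {W₂ : N₁ →L[ℂ] M₂} {W₃ : N₂ →L[ℂ] Z}
    (h₁ : ‖W₁‖ ≤ 1) (h₂ : ‖W₂‖ ≤ 1) (h₃ : ‖W₃‖ ≤ 1)
    (P : 𝒜 →L[ℂ] (M₁ →L[ℂ] N₁)) (Q : ℬ →L[ℂ] (M₂ →L[ℂ] N₂))
    {a : (Fin d → ℕ) → 𝒜} {b : (Fin d → ℕ) → ℬ} {A : 𝒜} {B : ℬ}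
    (ha : HasSum a A) (hb : HasSum b B)
    (ha' : Summable fun r => ‖a r‖) (hb' : Summable fun r => ‖b r‖)
    (hP : ‖P A‖ ≤ 1) (hQ : ‖Q B‖ ≤ 1) (K : (Fin d → ℕ) → 𝒞 →L[ℂ] (X →L[ℂ] Z))
    {e : (Fin d → ℕ) × (Fin d → ℕ) → 𝒞}
    (hK : ∀ p, K (p.1 + p.2) (e p) = W₃ ∘L Q (b p.2) ∘L W₂ ∘L P (a p.1) ∘L W₁) :
    ∃ C : X →L[ℂ] Z, HasSum (fun t => K t (∑ p ∈ addPairs t, e p)) C ∧ ‖C‖ ≤ 1 := by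
  -- The whole composition is one bounded bilinear map of the two inputs, so the product of the sums
  -- is a double sum. Since `K` depends only on `p.1 + p.2`, it comes out of each finite block by
  -- linearity.
  let Φ : 𝒜 →L[ℂ] ℬ →L[ℂ] (X →L[ℂ] Z) := ((ContinuousLinearMap.compL ℂ X M₂ Z).bilinearComp
    ((sandwichL W₃ (ContinuousLinearMap.id ℂ M₂)).comp Q) ((sandwichL W₂ W₁).comp P)).flip
  have hΦ : ∀ x y, Φ x y = (W₃ ∘L Q y) ∘L (W₂ ∘L P x ∘L W₁) := fun x y => rfl
  refine ⟨Φ A B, ?_, ?_⟩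
  · refine (HasSum.bilinear Φ ha hb ha' hb').sum_addPairs.congr_fun fun t => ?_
    rw [map_sum]
    refine Finset.sum_congr rfl fun p hp => ?_
    rw [← mem_addPairs.1 hp, hK]
    rfl
  · rw [hΦ]
    exact (ContinuousLinearMap.opNorm_comp_le _ _).trans (mul_le_one₀
      ((ContinuousLinearMap.opNorm_comp_le _ _).trans (mul_le_one₀ h₃ (norm_nonneg _) hQ))
      (norm_nonneg _) (norm_sandwichL_apply_le h₂ h₁ hP))

end OperatorComposition

section HilbertTensorInstances

/-! Shortcut instances, so that the algebraic and topological structures on `HilbertTensor E F` are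
found through its norm. -/

section Shortcuts

variable (E F : Type*) [NormedAddCommGroup E] [InnerProductSpace ℂ E]
  [NormedAddCommGroup F] [InnerProductSpace ℂ F]

/-- The additive group underlying the normed group `E ⊗ F`. -/
noncomputable abbrev HilbertTensor.addCommGroup : AddCommGroup (HilbertTensor E F) :=
  NormedAddCommGroup.toAddCommGroup

/-- The uniform structure underlying the normed group `E ⊗ F`. -/
noncomputable abbrev HilbertTensor.uniformSpace : UniformSpace (HilbertTensor E F) :=
  PseudoMetricSpace.toUniformSpace

attribute [local instance] HilbertTensor.addCommGroup HilbertTensor.uniformSpace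

/-- The module structure underlying the normed space `E ⊗ F`. -/
noncomputable abbrev HilbertTensor.module : Module ℂ (HilbertTensor E F) :=
  NormedSpace.toModule

end Shortcuts

attribute [local instance] HilbertTensor.addCommGroup HilbertTensor.uniformSpace
  HilbertTensor.module

/-! ### Hilbert space tensor products -/

namespace HilbertTensor

variable {E E' E'' F F' F'' G : Type*}
  [NormedAddCommGroup E] [InnerProductSpace ℂ E]
  [NormedAddCommGroup E'] [InnerProductSpace ℂ E']
  [NormedAddCommGroup E''] [InnerProductSpace ℂ E'']
  [NormedAddCommGroup F] [InnerProductSpace ℂ F]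
  [NormedAddCommGroup F'] [InnerProductSpace ℂ F']
  [NormedAddCommGroup F''] [InnerProductSpace ℂ F'']
  [NormedAddCommGroup G] [InnerProductSpace ℂ G]

theorem inner_mk (x x' : E) (y y' : F) :
    ⟪mk x y, mk x' y'⟫_ℂ = ⟪x, x'⟫_ℂ * ⟪y, y'⟫_ℂ := by
  simp [mk, UniformSpace.Completion.inner_coe]

theorem map_mk (A : E →L[ℂ] E') (B : F →L[ℂ] F') (x : E) (y : F) :
    map A B (mk x y) = mk (A x) (B y) := by
  simp [mk, map, ContinuousLinearMap.completion_apply_coe]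

variable (E F) in
/-- The continuous bilinear map `(x, y) ↦ x ⊗ y`. -/
noncomputable def mkL : E →L[ℂ] F →L[ℂ] HilbertTensor E F :=
  (ContinuousLinearMap.compL ℂ F (E ⊗[ℂ] F) (HilbertTensor E F)
    UniformSpace.Completion.toComplL).comp (TensorProduct.mkL ℂ E F)

theorem mkL_apply (x : E) (y : F) : mkL E F x y = mk x y := rfl

/-- Separate continuity: the closed span contains `a i ⊗ y` for every `y` by density of the span of
`b`, then `x ⊗ y` for every `x` by density of the span of `a`. -/
theorem dense_span_mk {ι κ : Type*} {a : ι → E} {b : κ → F}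
    (ha : Dense (Submodule.span ℂ (Set.range a) : Set E))
    (hb : Dense (Submodule.span ℂ (Set.range b) : Set F)) :
    Dense (Submodule.span ℂ (Set.range fun p : ι × κ => mk (a p.1) (b p.2)) :
      Set (HilbertTensor E F)) := by
  set K := (Submodule.span ℂ (Set.range fun p : ι × κ => mk (a p.1) (b p.2))).topologicalClosure
    with hK
  have hKc : IsClosed (K : Set (HilbertTensor E F)) := Submodule.isClosed_topologicalClosure _
  have h1 : ∀ i y, mk (a i) y ∈ K := fun i y => by
    have hcl : IsClosed {y | mkL E F (a i) y ∈ K} := hKc.preimage (mkL E F (a i)).continuous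
    refine (hcl.closure_subset_iff (s := (Submodule.span ℂ (Set.range b) : Set F))).2 ?_ (hb y)
    have : Submodule.span ℂ (Set.range b) ≤ K.comap (mkL E F (a i)).toLinearMap := by
      rw [Submodule.span_le]
      rintro _ ⟨j, rfl⟩
      exact Submodule.le_topologicalClosure _ (Submodule.subset_span ⟨(i, j), rfl⟩)
    exact this
  have h2 : ∀ x y, mk x y ∈ K := fun x y => by
    have hcl : IsClosed {x | (mkL E F).flip y x ∈ K} :=
      hKc.preimage ((mkL E F).flip y).continuous
    refine (hcl.closure_subset_iff (s := (Submodule.span ℂ (Set.range a) : Set E))).2 ?_ (ha x)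
    have : Submodule.span ℂ (Set.range a) ≤ K.comap ((mkL E F).flip y).toLinearMap := by
      rw [Submodule.span_le]
      rintro _ ⟨i, rfl⟩
      exact h1 i y
    exact this
  intro z
  change z ∈ K
  induction z using UniformSpace.Completion.induction_on with
  | hp => exact hKc
  | ih t =>
    induction t with
    | zero => exact K.zero_mem
    | tmul x y => exact h2 x y
    | add s t hs ht =>
      rw [UniformSpace.Completion.coe_add]
      exact K.add_mem hs ht

theorem dense_span_range_id : Dense (Submodule.span ℂ (Set.range (id : E → E)) : Set E) := by
  simp

theorem dense_span_mk_id :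
    Dense (Submodule.span ℂ (Set.range fun p : E × F => mk p.1 p.2) : Set (HilbertTensor E F)) :=
  dense_span_mk (a := (id : E → E)) (b := (id : F → F)) dense_span_range_id dense_span_range_id

theorem dense_span_mk_mk :
    Dense (Submodule.span ℂ (Set.range fun p : (E × F) × G => mk (mk p.1.1 p.1.2) p.2) :
      Set (HilbertTensor (HilbertTensor E F) G)) := by
  have h := dense_span_mk (E := HilbertTensor E F) (F := G) (a := fun p : E × F => mk p.1 p.2)
    (b := (id : G → G)) dense_span_mk_id dense_span_range_id
  exact h

/-- Operators that agree on the elementary tensors are equal. -/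
theorem ext_mk {A B : HilbertTensor E F →L[ℂ] E''}
    (h : ∀ x y, A (mk x y) = B (mk x y)) : A = B := by
  refine ContinuousLinearMap.ext_on dense_span_mk_id ?_
  rintro _ ⟨p, rfl⟩
  exact h _ _

theorem ext_mk_mk {A B : HilbertTensor (HilbertTensor E F) G →L[ℂ] E''}
    (h : ∀ x y z, A (mk (mk x y) z) = B (mk (mk x y) z)) : A = B := by
  refine ContinuousLinearMap.ext_on dense_span_mk_mk ?_
  rintro _ ⟨p, rfl⟩
  exact h _ _ _

theorem norm_map_le (A : E →L[ℂ] E') (B : F →L[ℂ] F') : ‖map A B‖ ≤ ‖A‖ * ‖B‖ := by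
  refine ContinuousLinearMap.opNorm_le_bound _ (by positivity) fun z => ?_
  induction z using UniformSpace.Completion.induction_on with
  | hp =>
    exact isClosed_le (map A B).continuous.norm (continuous_const.mul continuous_norm)
  | ih t =>
    rw [map, ContinuousLinearMap.completion_apply_coe, UniformSpace.Completion.norm_coe,
      UniformSpace.Completion.norm_coe]
    exact ((TensorProduct.mapL A B).le_opNorm t).trans
      (mul_le_mul_of_nonneg_right (TensorProduct.norm_mapL_le A B) (norm_nonneg _))

theorem map_comp_map (A : E →L[ℂ] E') (A' : E' →L[ℂ] E'') (B : F →L[ℂ] F')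
    (B' : F' →L[ℂ] F'') : map A' B' ∘L map A B = map (A' ∘L A) (B' ∘L B) :=
  ext_mk fun x y => by simp [map_mk]

theorem map_add_left (A A' : E →L[ℂ] E') (B : F →L[ℂ] F') :
    map (A + A') B = map A B + map A' B :=
  ext_mk fun x y => by
    rw [_root_.add_apply, map_mk, map_mk, map_mk, _root_.add_apply,
      ← mkL_apply, map_add, _root_.add_apply, mkL_apply, mkL_apply]

theorem map_add_right (A : E →L[ℂ] E') (B B' : F →L[ℂ] F') :
    map A (B + B') = map A B + map A B' :=
  ext_mk fun x y => by
    rw [_root_.add_apply, map_mk, map_mk, map_mk, _root_.add_apply,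
      ← mkL_apply, map_add, mkL_apply, mkL_apply]

theorem map_smul_left (r : ℂ) (A : E →L[ℂ] E') (B : F →L[ℂ] F') :
    map (r • A) B = r • map A B :=
  ext_mk fun x y => by
    rw [_root_.smul_apply, map_mk, map_mk, _root_.smul_apply,
      ← mkL_apply, map_smul, _root_.smul_apply, mkL_apply]

theorem map_smul_right (r : ℂ) (A : E →L[ℂ] E') (B : F →L[ℂ] F') :
    map A (r • B) = r • map A B :=
  ext_mk fun x y => by
    rw [_root_.smul_apply, map_mk, map_mk, _root_.smul_apply,
      ← mkL_apply, map_smul, mkL_apply]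

variable (E E' F F') in
/-- The bilinear map `(A, B) ↦ A ⊗ B` on operators. -/
noncomputable def mapₗ : (E →L[ℂ] E') →ₗ[ℂ] (F →L[ℂ] F') →ₗ[ℂ]
    (HilbertTensor E F →L[ℂ] HilbertTensor E' F') where
  toFun A :=
    { toFun := fun B => map A B
      map_add' := map_add_right A
      map_smul' := fun r B => map_smul_right r A B }
  map_add' A A' := LinearMap.ext fun B => map_add_left A A' B
  map_smul' r A := LinearMap.ext fun B => map_smul_left r A B

variable (E E' F F') in
/-- The continuous bilinear map `(A, B) ↦ A ⊗ B` on operators. -/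
noncomputable def mapL : (E →L[ℂ] E') →L[ℂ] (F →L[ℂ] F') →L[ℂ]
    (HilbertTensor E F →L[ℂ] HilbertTensor E' F') :=
  (mapₗ E E' F F').mkContinuous₂ 1 fun A B => by rw [one_mul]; exact norm_map_le A B

theorem mapL_apply (A : E →L[ℂ] E') (B : F →L[ℂ] F') : mapL E E' F F' A B = map A B := rfl

end HilbertTensor

/-- A family with dense span is mapped to any family with the same Gram matrix by a contraction. -/
theorem exists_contraction_of_inner_eq {ι E F : Type*}
    [NormedAddCommGroup E] [InnerProductSpace ℂ E]
    [NormedAddCommGroup F] [InnerProductSpace ℂ F] [CompleteSpace F] {a : ι → E} {b : ι → F}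
    (ha : Dense (Submodule.span ℂ (Set.range a) : Set E))
    (h : ∀ i j, ⟪b i, b j⟫_ℂ = ⟪a i, a j⟫_ℂ) :
    ∃ W : E →L[ℂ] F, ‖W‖ ≤ 1 ∧ ∀ i, W (a i) = b i := by
  -- The Gram matrix determines the norm of every linear combination, so sending combinations of `a`
  -- to those of `b` is well defined and extends by density.
  have hn : ∀ x : ι →₀ ℂ, ‖Finsupp.linearCombination ℂ b x‖ ≤
      1 * ‖Finsupp.linearCombination ℂ a x‖ := fun x => by
    rw [one_mul, @norm_eq_sqrt_re_inner ℂ, @norm_eq_sqrt_re_inner ℂ]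
    simp only [Finsupp.linearCombination_apply, Finsupp.sum, sum_inner, inner_sum,
      inner_smul_left, inner_smul_right, h]
    exact le_rfl
  have hd : DenseRange (Finsupp.linearCombination ℂ a) := by
    rw [← Finsupp.range_linearCombination] at ha
    exact ha
  refine ⟨(Finsupp.linearCombination ℂ b).extendOfNorm (Finsupp.linearCombination ℂ a),
    LinearMap.opNorm_extendOfNorm_le hd zero_le_one hn, fun i => ?_⟩
  have := LinearMap.extendOfNorm_eq hd ⟨1, hn⟩ (Finsupp.single i 1)
  simpa using this

/-! ### Permutations of three tensor factors -/

namespace HilbertTensor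

variable (E F G : Type*)
  [NormedAddCommGroup E] [InnerProductSpace ℂ E]
  [NormedAddCommGroup F] [InnerProductSpace ℂ F]
  [NormedAddCommGroup G] [InnerProductSpace ℂ G]

/-- Reordering factors only permutes the factors of the scalar product of elementary tensors, so the
Gram matrices agree. Contractivity is enough here; unitarity plays no role. -/
theorem exists_swap_right :
    ∃ W : HilbertTensor (HilbertTensor E F) G →L[ℂ] HilbertTensor (HilbertTensor E G) F,
      ‖W‖ ≤ 1 ∧ ∀ x y z, W (mk (mk x y) z) = mk (mk x z) y := by
  obtain ⟨W, h1, hW⟩ := exists_contraction_of_inner_eq (dense_span_mk_mk (E := E) (F := F) (G := G))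
    (b := fun p : (E × F) × G =>
      (mk (mk p.1.1 p.2) p.1.2 : HilbertTensor (HilbertTensor E G) F))
    fun p q => by rw [inner_mk, inner_mk, inner_mk, inner_mk]; ring
  exact ⟨W, h1, fun x y z => hW ((x, y), z)⟩

theorem exists_swap_outer :
    ∃ W : HilbertTensor (HilbertTensor E F) G →L[ℂ] HilbertTensor (HilbertTensor G F) E,
      ‖W‖ ≤ 1 ∧ ∀ x y z, W (mk (mk x y) z) = mk (mk z y) x := by
  obtain ⟨W, h1, hW⟩ := exists_contraction_of_inner_eq (dense_span_mk_mk (E := E) (F := F) (G := G))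
    (b := fun p : (E × F) × G =>
      (mk (mk p.2 p.1.2) p.1.1 : HilbertTensor (HilbertTensor G F) E))
    fun p q => by rw [inner_mk, inner_mk, inner_mk, inner_mk]; ring
  exact ⟨W, h1, fun x y z => hW ((x, y), z)⟩

theorem exists_rotate :
    ∃ W : HilbertTensor (HilbertTensor E F) G →L[ℂ] HilbertTensor (HilbertTensor G E) F,
      ‖W‖ ≤ 1 ∧ ∀ x y z, W (mk (mk x y) z) = mk (mk z x) y := by
  obtain ⟨W, h1, hW⟩ := exists_contraction_of_inner_eq (dense_span_mk_mk (E := E) (F := F) (G := G))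
    (b := fun p : (E × F) × G =>
      (mk (mk p.2 p.1.1) p.1.2 : HilbertTensor (HilbertTensor G E) F))
    fun p q => by rw [inner_mk, inner_mk, inner_mk, inner_mk]; ring
  exact ⟨W, h1, fun x y z => hW ((x, y), z)⟩

theorem norm_map_id_le {E F G : Type*}
    [NormedAddCommGroup E] [InnerProductSpace ℂ E]
    [NormedAddCommGroup F] [InnerProductSpace ℂ F]
    [NormedAddCommGroup G] [InnerProductSpace ℂ G] (A : E →L[ℂ] F) :
    ‖map A (ContinuousLinearMap.id ℂ G)‖ ≤ ‖A‖ :=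
  (norm_map_le A _).trans
    (mul_le_of_le_one_right (norm_nonneg _) ContinuousLinearMap.norm_id_le)

/-- The continuous linear map `A ↦ A ⊗ T` on operators. -/
noncomputable def mapRightL {G : Type*} [NormedAddCommGroup G] [InnerProductSpace ℂ G]
    (T : G →L[ℂ] G) : (E →L[ℂ] F) →L[ℂ] (HilbertTensor E G →L[ℂ] HilbertTensor F G) :=
  (mapL E F G G).flip T

/-- The continuous linear map `A ↦ A ⊗ 1` on operators. -/
noncomputable def mapIdL : (E →L[ℂ] F) →L[ℂ] (HilbertTensor E G →L[ℂ] HilbertTensor F G) :=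
  mapRightL E F (ContinuousLinearMap.id ℂ G)

theorem mapIdL_apply {E F G : Type*}
    [NormedAddCommGroup E] [InnerProductSpace ℂ E]
    [NormedAddCommGroup F] [InnerProductSpace ℂ F]
    [NormedAddCommGroup G] [InnerProductSpace ℂ G] (A : E →L[ℂ] F) :
    mapIdL E F G A = map A (ContinuousLinearMap.id ℂ G) := rfl

end HilbertTensor

open HilbertTensor

/-- Operators on `U₁ ⊗ H` and `U₂ ⊗ H`, amplified to `U₁ ⊗ U₂ ⊗ H`, compose to `a ⊗ b ⊗ TS`. -/
theorem exists_amplification (U₁ U₂ V₁ V₂ H : Type*)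
    [NormedAddCommGroup U₁] [InnerProductSpace ℂ U₁]
    [NormedAddCommGroup U₂] [InnerProductSpace ℂ U₂]
    [NormedAddCommGroup V₁] [InnerProductSpace ℂ V₁]
    [NormedAddCommGroup V₂] [InnerProductSpace ℂ V₂]
    [NormedAddCommGroup H] [InnerProductSpace ℂ H] :
    ∃ (W₁ : HilbertTensor (HilbertTensor U₁ U₂) H →L[ℂ] HilbertTensor (HilbertTensor U₁ H) U₂)
      (W₂ : HilbertTensor (HilbertTensor V₁ H) U₂ →L[ℂ] HilbertTensor (HilbertTensor U₂ H) V₁)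
      (W₃ : HilbertTensor (HilbertTensor V₂ H) V₁ →L[ℂ] HilbertTensor (HilbertTensor V₁ V₂) H),
      ‖W₁‖ ≤ 1 ∧ ‖W₂‖ ≤ 1 ∧ ‖W₃‖ ≤ 1 ∧
      ∀ a b S T, map (map a b) (T ∘L S) = W₃ ∘L mapIdL _ _ V₁ (map b T) ∘L W₂ ∘L
        mapIdL _ _ U₂ (map a S) ∘L W₁ := by
  obtain ⟨W₁, n₁, h₁⟩ := exists_swap_right U₁ U₂ H
  obtain ⟨W₂, n₂, h₂⟩ := exists_swap_outer V₁ H U₂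
  obtain ⟨W₃, n₃, h₃⟩ := exists_rotate V₂ H V₁
  -- On an elementary tensor the right side acts as `x⊗y⊗z ↦ x⊗z⊗y ↦ ax⊗Sz⊗y ↦ y⊗Sz⊗ax ↦ by⊗TSz⊗ax ↦
  -- ax⊗by⊗TSz`.
  refine ⟨W₁, W₂, W₃, n₁, n₂, n₃, fun a b S T => ext_mk_mk fun x y z => ?_⟩
  simp only [mapIdL_apply, ContinuousLinearMap.comp_apply, map_mk, h₁, h₂, h₃,
    ContinuousLinearMap.id_apply]

/-! ### Operations on the Schur–Agler class -/

section SchurAgler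

variable {d : ℕ}

theorem HasPolydiskExpansion.summable_norm_map {U V H : Type*}
    [NormedAddCommGroup U] [InnerProductSpace ℂ U] [NormedAddCommGroup V] [InnerProductSpace ℂ V]
    [NormedAddCommGroup H] [InnerProductSpace ℂ H]
    {c : (Fin d → ℕ) → U →L[ℂ] V} {f : (Fin d → ℂ) → U →L[ℂ] V} (h : HasPolydiskExpansion c f)
    {T : Fin d → H →L[ℂ] H} (hT : ∀ i, ‖T i‖ < 1) :
    Summable fun r => ‖map (c r) (opMonomial T r)‖ :=
  Summable.of_nonneg_of_le (fun _ => ContinuousLinearMap.opNorm_nonneg _)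
    (fun r => (norm_map_le _ _).trans
      (mul_le_mul_of_nonneg_left (norm_opMonomial_le T r) (norm_nonneg _)))
    (h.summable_norm (fun i => norm_nonneg (T i)) hT)

set_option maxHeartbeats 2000000 in
-- The coefficients are the Cauchy product of the two families. Absolute summability, both at points
-- of the polydisk and at `T`, justifies the rearrangement, and the amplified `f(T)` and `g(T)`
-- supply the norm bound.
theorem IsSchurAgler.tensor {U₁ : Type*} {U₂ : Type*} {V₁ : Type*} {V₂ : Type*}
    [NormedAddCommGroup U₁] [InnerProductSpace ℂ U₁]
    [NormedAddCommGroup U₂] [InnerProductSpace ℂ U₂]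
    [NormedAddCommGroup V₁] [InnerProductSpace ℂ V₁]
    [NormedAddCommGroup V₂] [InnerProductSpace ℂ V₂]
    {f : (Fin d → ℂ) → U₁ →L[ℂ] V₁} {g : (Fin d → ℂ) → U₂ →L[ℂ] V₂}
    (hf : IsSchurAgler.{_, _, w} f) (hg : IsSchurAgler.{_, _, w} g) :
    IsSchurAgler.{_, _, w} fun z => map (f z) (g z) := by
  obtain ⟨hfa, a, hfe, hfT⟩ := hf
  obtain ⟨hga, b, hge, hgT⟩ := hg
  refine ⟨fun z hz => ?_, fun t => ∑ p ∈ addPairs t, map (a p.1) (b p.2), fun z hz => ?_, ?_⟩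
  · exact AnalyticAt.fun_comp (f := fun z => (f z, g z))
      ((mapL U₁ V₁ U₂ V₂).analyticAt_bilinear (f z, g z)) ((hfa z hz).prod (hga z hz))
  · have sa : Summable fun r => ‖(∏ i, z i ^ r i) • a r‖ := by
      refine (hfe.summable_norm (fun i => norm_nonneg (z i)) hz).congr fun r => ?_
      rw [norm_smul, norm_prod, mul_comm]; simp
    have sb : Summable fun r => ‖(∏ i, z i ^ r i) • b r‖ := by
      refine (hge.summable_norm (fun i => norm_nonneg (z i)) hz).congr fun r => ?_
      rw [norm_smul, norm_prod, mul_comm]; simp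
    refine (HasSum.bilinear (mapL U₁ V₁ U₂ V₂) (hfe z hz) (hge z hz) sa sb).sum_addPairs.congr_fun
      fun t => ?_
    rw [Finset.smul_sum]
    refine Finset.sum_congr rfl fun p hp => ?_
    rw [mapL_apply, map_smul_left, map_smul_right, smul_smul, ← Finset.prod_mul_distrib,
      ← mem_addPairs.1 hp]
    simp only [Pi.add_apply, pow_add]
  · intro H _ _ _ T hT hT1
    obtain ⟨fT, hfs, hfn⟩ := hfT H T hT hT1
    obtain ⟨gT, hgs, hgn⟩ := hgT H T hT hT1
    obtain ⟨W₁, W₂, W₃, n₁, n₂, n₃, hW⟩ := exists_amplification U₁ U₂ V₁ V₂ H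
    refine exists_hasSum_sandwich n₁ n₂ n₃ (mapIdL _ _ U₂) (mapIdL _ _ V₁) hfs hgs
      (hfe.summable_norm_map hT1) (hge.summable_norm_map hT1)
      ((norm_map_id_le fT).trans hfn) ((norm_map_id_le gT).trans hgn)
      (fun t => mapRightL (HilbertTensor U₁ U₂) (HilbertTensor V₁ V₂) (opMonomial T t))
      fun p => ?_
    -- The factor coming from `f` acts first, so its monomial must stand on the right.
    rw [add_comm, opMonomial_add hT]
    exact hW _ _ _ _

/-- Evaluation at `T` gives `(B ⊗ 1) f(T) (A ⊗ 1)`, a product of contractions. -/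
theorem IsSchurAgler.compress {U : Type*} {V : Type*} {U' : Type*} {V' : Type*}
    [NormedAddCommGroup U] [InnerProductSpace ℂ U] [NormedAddCommGroup V] [InnerProductSpace ℂ V]
    [NormedAddCommGroup U'] [InnerProductSpace ℂ U']
    [NormedAddCommGroup V'] [InnerProductSpace ℂ V']
    {f : (Fin d → ℂ) → U →L[ℂ] V} (hf : IsSchurAgler.{_, _, w} f)
    {A : U' →L[ℂ] U} {B : V →L[ℂ] V'} (hA : ‖A‖ ≤ 1) (hB : ‖B‖ ≤ 1) :
    IsSchurAgler.{_, _, w} fun z => B ∘L f z ∘L A := by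
  obtain ⟨hfa, c, hfe, hfT⟩ := hf
  refine ⟨fun z hz => ((sandwichL B A).analyticAt (f z)).fun_comp (hfa z hz),
    fun r => B ∘L c r ∘L A, fun z hz => ?_, ?_⟩
  · have h := (sandwichL B A).hasSum (hfe z hz)
    simp only [map_smul] at h
    exact h
  · intro H _ _ _ T hT hT1
    obtain ⟨fT, hs, hn⟩ := hfT H T hT hT1
    let M : (HilbertTensor U H →L[ℂ] HilbertTensor V H) →L[ℂ]
        (HilbertTensor U' H →L[ℂ] HilbertTensor V' H) :=
      sandwichL (map B (ContinuousLinearMap.id ℂ H)) (map A (ContinuousLinearMap.id ℂ H))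
    refine ⟨M fT, (M.hasSum hs).congr_fun fun r => ?_,
      norm_sandwichL_apply_le ((norm_map_id_le B).trans hB) ((norm_map_id_le A).trans hA) hn⟩
    change _ = map B (ContinuousLinearMap.id ℂ H) ∘L map (c r) (opMonomial T r) ∘L
      map A (ContinuousLinearMap.id ℂ H)
    rw [map_comp_map, map_comp_map]
    rfl

/-- Only the coefficient at `r = 0` survives, and `T^0 = 1`, so the value at `T` is `A ⊗ 1`. This
starts the induction on tensor powers. -/
theorem IsSchurAgler.const {U : Type*} {V : Type*}
    [NormedAddCommGroup U] [InnerProductSpace ℂ U] [NormedAddCommGroup V] [InnerProductSpace ℂ V]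
    {A : U →L[ℂ] V} (hA : ‖A‖ ≤ 1) :
    IsSchurAgler.{_, _, w} fun _ : Fin d → ℂ => A := by
  refine ⟨fun z _ => analyticAt_const, fun r => if r = 0 then A else 0, fun z _ => ?_, ?_⟩
  · have h := hasSum_single (f := fun r : Fin d → ℕ => (∏ i, z i ^ r i) • if r = 0 then A else 0) 0
      fun r hr => by simp [hr]
    simpa using h
  · intro H _ _ _ T _ _
    refine ⟨map A (ContinuousLinearMap.id ℂ H), ?_, (norm_map_id_le A).trans hA⟩
    have h := hasSum_single
      (f := fun r : Fin d → ℕ => map (if r = 0 then A else 0) (opMonomial T r)) 0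
      fun r hr => by simp only [hr, if_false]; rw [← mapL_apply, map_zero]; rfl
    simp only [if_true, opMonomial_zero] at h
    exact h

end SchurAgler

end HilbertTensorInstances

/-! ### Tensor powers -/

theorem isSchurAgler_tensorFun {d : ℕ} {U : Type u} {V : Type v}
    [NormedAddCommGroup U] [InnerProductSpace ℂ U] [NormedAddCommGroup V] [InnerProductSpace ℂ V] :
    ∀ {k : ℕ} {S : Fin k → (Fin d → ℂ) → U →L[ℂ] V}, (∀ j, IsSchurAgler.{u, v, w} (S j)) →
      IsSchurAgler.{u, v, w} (tensorFun S)
  | 0, _, _ => IsSchurAgler.const (A := TensorPow.map (U := U) (V := V) 0 Fin.elim0)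
    (LinearIsometry.norm_toContinuousLinearMap_le (LinearIsometryEquiv.piLpCongrLeft 2 ℂ ℂ
      (Equiv.punitEquivPUnit : PUnit.{u + 1} ≃ PUnit.{v + 1})).toLinearIsometry)
  | _ + 1, _, hS =>
    (isSchurAgler_tensorFun fun j => hS j.castSucc).tensor (hS (Fin.last _))

theorem isSchurAgler_wedgeFun {d k : ℕ} {U : Type u} {V : Type v}
    [NormedAddCommGroup U] [InnerProductSpace ℂ U] [NormedAddCommGroup V] [InnerProductSpace ℂ V]
    {S : Fin k → (Fin d → ℂ) → U →L[ℂ] V} (hS : ∀ j, IsSchurAgler.{u, v, w} (S j)) :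
    IsSchurAgler.{u, v, w} (wedgeFun S) :=
  (isSchurAgler_tensorFun hS).compress (Submodule.norm_subtypeL_le _)
    (Submodule.orthogonalProjectionOnto_norm_le _)

/-! ### Gram determinants of elementary antisymmetric tensors. -/

namespace TensorPow

variable {U : Type u} {V : Type v} [NormedAddCommGroup U] [InnerProductSpace ℂ U]
  [NormedAddCommGroup V] [InnerProductSpace ℂ V]

theorem inner_tprod : ∀ (k : ℕ) (x y : Fin k → U),
    ⟪tprod k x, tprod k y⟫_ℂ = ∏ i, ⟪x i, y i⟫_ℂ
  | 0, x, y => by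
    have h : ⟪(EuclideanSpace.single PUnit.unit 1 : EuclideanSpace ℂ PUnit.{u + 1}),
      EuclideanSpace.single PUnit.unit 1⟫_ℂ = 1 := by simp
    rw [Fin.prod_univ_zero]
    exact h
  | k + 1, x, y => by
    rw [Fin.prod_univ_castSucc, ← inner_tprod k]
    exact HilbertTensor.inner_mk _ _ _ _

theorem map_tprod : ∀ (k : ℕ) (A : Fin k → U →L[ℂ] V) (x : Fin k → U),
    map k A (tprod k x) = tprod k fun i => A i (x i)
  | 0, A, x => by
    have h : LinearIsometryEquiv.piLpCongrLeft 2 ℂ ℂ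
      (Equiv.punitEquivPUnit : PUnit.{u + 1} ≃ PUnit.{v + 1})
        (EuclideanSpace.single PUnit.unit 1) = EuclideanSpace.single PUnit.unit 1 := by
      ext; simp
    exact h
  | k + 1, A, x => by
    have h := HilbertTensor.map_mk (map k fun i => A i.castSucc) (A (Fin.last k))
      (tprod k fun i => x i.castSucc) (x (Fin.last k))
    rw [map_tprod k] at h
    exact h

theorem map_wedge (k : ℕ) (A : U →L[ℂ] V) (x : Fin k → U) :
    map k (fun _ => A) (wedge k x) = wedge k fun i => A (x i) := by
  simp only [wedge, map_sum, map_smul, map_tprod]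

theorem inner_wedge (k : ℕ) (x y : Fin k → U) :
    ⟪wedge k x, wedge k y⟫_ℂ =
      (k.factorial : ℂ) * (Matrix.of fun i j => ⟪x i, y j⟫_ℂ).det := by
  set M : Matrix (Fin k) (Fin k) ℂ := Matrix.of fun i j => ⟪x i, y j⟫_ℂ
  -- For fixed `τ` the sum over `σ` is the determinant of `M` with columns permuted by `τ`. The two
  -- signs of `τ` then cancel, leaving `k!` equal terms.
  have h1 : ∀ τ : Equiv.Perm (Fin k), ∑ σ : Equiv.Perm (Fin k),
      ((Equiv.Perm.sign σ : ℤ) : ℂ) * ∏ i, ⟪x (σ i), y (τ i)⟫_ℂ =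
        ((Equiv.Perm.sign τ : ℤ) : ℂ) * M.det := fun τ => by
    rw [← Matrix.det_permute', Matrix.det_apply']
    rfl
  have h2 : ∀ σ : Equiv.Perm (Fin k),
      ((Equiv.Perm.sign σ : ℤ) : ℂ) * ((Equiv.Perm.sign σ : ℤ) : ℂ) = 1 := fun σ => by
    rw [← Int.cast_mul, ← Units.val_mul, Int.units_mul_self]
    simp
  simp only [wedge, sum_inner, inner_sum, inner_smul_left, inner_smul_right, inner_tprod,
    map_intCast]
  rw [Finset.sum_congr rfl fun σ _ => by rw [h1, ← mul_assoc, h2, one_mul]]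
  simp [Fintype.card_perm]

/-- The elementary antisymmetric tensor `v_1 ∧ ⋯ ∧ v_k`, divided by `√k!`. -/
noncomputable def normalizedWedge (k : ℕ) (x : Fin k → U) : TensorPow k U :=
  (((√(k.factorial : ℝ) : ℝ) : ℂ)⁻¹) • wedge k x

theorem inner_normalizedWedge (k : ℕ) (x y : Fin k → U) :
    ⟪normalizedWedge k x, normalizedWedge k y⟫_ℂ = (Matrix.of fun i j => ⟪x i, y j⟫_ℂ).det := by
  have h : ((√(k.factorial : ℝ) : ℝ) : ℂ) * ((√(k.factorial : ℝ) : ℝ) : ℂ) = k.factorial := by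
    rw [← Complex.ofReal_mul, Real.mul_self_sqrt (Nat.cast_nonneg _), Complex.ofReal_natCast]
  have h0 : (k.factorial : ℂ) ≠ 0 := Nat.cast_ne_zero.2 k.factorial_ne_zero
  rw [normalizedWedge, normalizedWedge, inner_smul_left, inner_smul_right, inner_wedge, map_inv₀,
    Complex.conj_ofReal, ← mul_assoc, ← mul_assoc, ← mul_inv, h, inv_mul_cancel₀ h0, one_mul]

theorem map_normalizedWedge (k : ℕ) (A : U →L[ℂ] V) (x : Fin k → U) :
    map k (fun _ => A) (normalizedWedge k x) = normalizedWedge k fun i => A (x i) := by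
  rw [normalizedWedge, map_smul, map_wedge, normalizedWedge]

end TensorPow

/-! ### Compound matrices -/

theorem inner_single_toEuclideanCLM {ι : Type*} [Fintype ι] [DecidableEq ι] (M : Matrix ι ι ℂ)
    (i j : ι) : ⟪(EuclideanSpace.single i 1 : EuclideanSpace ℂ ι),
      Matrix.toEuclideanCLM (n := ι) (𝕜 := ℂ) M (EuclideanSpace.single j 1)⟫_ℂ = M i j := by
  rw [EuclideanSpace.inner_single_left]
  simp

theorem toEuclideanCLM_eq_of_inner {ι : Type*} [Fintype ι] [DecidableEq ι] {M : Matrix ι ι ℂ}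
    {A : EuclideanSpace ℂ ι →L[ℂ] EuclideanSpace ℂ ι}
    (h : ∀ i j, ⟪(EuclideanSpace.single i 1 : EuclideanSpace ℂ ι),
      A (EuclideanSpace.single j 1)⟫_ℂ = M i j) :
    Matrix.toEuclideanCLM (n := ι) (𝕜 := ℂ) M = A := by
  refine ContinuousLinearMap.coe_injective
    ((EuclideanSpace.basisFun ι ℂ).toBasis.ext fun j => ?_)
  ext i
  have h1 := h i j
  have h2 := inner_single_toEuclideanCLM M i j
  rw [EuclideanSpace.inner_single_left] at h1 h2
  simpa using h2.trans h1.symm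

/-- If `I ≠ J` have equal size, some `a ∈ I` lies outside `J`, and the row of `a` in the minor
vanishes. This encodes the orthonormality of `wedgeBasis`. -/
theorem compoundMatrix_one {n : ℕ} (k : ℕ) :
    compoundMatrix k (1 : Matrix (Fin n) (Fin n) ℂ) = 1 := by
  ext I J
  rw [compoundMatrix, Matrix.of_apply]
  by_cases h : I = J
  · subst h
    rw [Matrix.submatrix_one _ (I.1.orderEmbOfFin I.2).injective, Matrix.det_one, Matrix.one_apply_eq]
  · rw [Matrix.one_apply_ne h]
    obtain ⟨a, ha, hb⟩ : ∃ a ∈ I.1, a ∉ J.1 := by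
      by_contra! hc
      exact h (Subtype.ext (Finset.eq_of_subset_of_card_le hc (by rw [I.2, J.2])))
    obtain ⟨i, hi⟩ : a ∈ Set.range (I.1.orderEmbOfFin I.2) := by
      rw [Finset.range_orderEmbOfFin]; exact ha
    refine Matrix.det_eq_zero_of_row_eq_zero i fun j => ?_
    rw [Matrix.submatrix_apply, hi, Matrix.one_apply_ne]
    rintro rfl
    exact hb (Finset.orderEmbOfFin_mem J.1 J.2 j)

/-- The normalized antisymmetric tensor of the standard basis vectors with indices in `I`. -/
noncomputable def wedgeBasis {n k : ℕ} (I : {s : Finset (Fin n) // s.card = k}) :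
    TensorPow k (EuclideanSpace ℂ (Fin n)) :=
  TensorPow.normalizedWedge k fun i => EuclideanSpace.single (I.1.orderEmbOfFin I.2 i) 1

/-- The tensor power of `M` applies `M` to each wedge factor, so the coefficient is the Gram
determinant of the vectors `e_i` against `M e_j`, whose entries are those of `M`. -/
theorem inner_wedgeBasis_map {n k : ℕ} (M : Matrix (Fin n) (Fin n) ℂ)
    (I J : {s : Finset (Fin n) // s.card = k}) :
    ⟪wedgeBasis I, TensorPow.map k (fun _ => Matrix.toEuclideanCLM (n := Fin n) (𝕜 := ℂ) M)
      (wedgeBasis J)⟫_ℂ = compoundMatrix k M I J := by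
  rw [wedgeBasis, wedgeBasis, TensorPow.map_normalizedWedge, TensorPow.inner_normalizedWedge]
  simp only [inner_single_toEuclideanCLM]
  rfl

theorem orthonormal_wedgeBasis {n k : ℕ} :
    Orthonormal ℂ (wedgeBasis : {s : Finset (Fin n) // s.card = k} → _) := by
  rw [orthonormal_iff_ite]
  intro I J
  rw [wedgeBasis, wedgeBasis, TensorPow.inner_normalizedWedge, ← Matrix.one_apply,
    ← compoundMatrix_one]
  simp only [EuclideanSpace.inner_single_left, map_one, one_mul]
  rw [compoundMatrix, Matrix.of_apply]
  congr 1
  ext i j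
  simp [Matrix.one_apply]

/-- Sending the standard basis to `wedgeBasis` defines an isometry `L` into the full tensor power,
and the compound matrix is `L* (S ⊗ ⋯ ⊗ S) L`. -/
theorem isMatrixSchurAgler_compoundMatrix {d n : ℕ} {S : (Fin d → ℂ) → Matrix (Fin n) (Fin n) ℂ}
    (hS : IsMatrixSchurAgler.{w} S) (k : ℕ) :
    IsMatrixSchurAgler.{w} fun z => compoundMatrix k (S z) := by
  let b := (EuclideanSpace.basisFun {s : Finset (Fin n) // s.card = k} ℂ)
  have hb : Orthonormal ℂ b.toBasis := by
    rw [b.coe_toBasis]; exact b.orthonormal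
  have hv : (b.toBasis.constr ℂ wedgeBasis : _ →ₗ[ℂ] TensorPow k (EuclideanSpace ℂ (Fin n))) ∘
      b.toBasis = wedgeBasis := by
    ext1 I
    exact b.toBasis.constr_basis ℂ _ I
  let L := (b.toBasis.constr ℂ wedgeBasis :
    _ →ₗ[ℂ] TensorPow k (EuclideanSpace ℂ (Fin n))).isometryOfOrthonormal hb
      (by rw [hv]; exact orthonormal_wedgeBasis)
  have hL : ∀ I, L.toContinuousLinearMap (EuclideanSpace.single I 1) = wedgeBasis I := fun I => by
    have hI : b.toBasis I = EuclideanSpace.single I 1 := by simp [b]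
    rw [← hI]
    exact congrFun hv I
  have hn : ‖L.toContinuousLinearMap‖ ≤ 1 := L.norm_toContinuousLinearMap_le
  have h := (isSchurAgler_tensorFun (k := k) fun _ => hS).compress hn
    (B := L.toContinuousLinearMap.adjoint) (by rwa [LinearIsometryEquiv.norm_map])
  refine (congrArg IsSchurAgler (funext fun z => ?_)).mpr h
  refine toEuclideanCLM_eq_of_inner fun I J => ?_
  rw [ContinuousLinearMap.comp_apply, ContinuousLinearMap.comp_apply,
    ContinuousLinearMap.adjoint_inner_right, hL, hL]
  exact inner_wedgeBasis_map (S z) I J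

/-- The determinant is the compression of the `n`-th tensor power to the line of the unit vector
`e_1 ∧ ⋯ ∧ e_n / √n!`. Working with this vector directly avoids identifying a one-element index set
and covers `n = 0`. -/
theorem isScalarSchurAgler_det {d n : ℕ} {S : (Fin d → ℂ) → Matrix (Fin n) (Fin n) ℂ}
    (hS : IsMatrixSchurAgler.{w} S) : IsScalarSchurAgler.{w} fun z => (S z).det := by
  let x : TensorPow n (EuclideanSpace ℂ (Fin n)) :=
    TensorPow.normalizedWedge n fun i => EuclideanSpace.single i 1
  have hx : ∀ M : Matrix (Fin n) (Fin n) ℂ, ⟪x, TensorPow.map n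
      (fun _ => Matrix.toEuclideanCLM (n := Fin n) (𝕜 := ℂ) M) x⟫_ℂ = M.det := fun M => by
    rw [TensorPow.map_normalizedWedge, TensorPow.inner_normalizedWedge]
    simp only [inner_single_toEuclideanCLM]
    rfl
  have hx1 : ‖x‖ ≤ 1 := by
    have h : ⟪x, x⟫_ℂ = 1 := by
      rw [TensorPow.inner_normalizedWedge, ← Matrix.det_one (n := Fin n)]
      congr 1
      ext i j
      simp [Matrix.one_apply, EuclideanSpace.inner_single_left]
    have h' : ‖x‖ ^ 2 = 1 := by
      rw [← inner_self_eq_norm_sq (𝕜 := ℂ), h, RCLike.one_re]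
    nlinarith [norm_nonneg x]
  have h := (isSchurAgler_tensorFun (k := n) fun _ => hS).compress
    (A := ContinuousLinearMap.toSpanSingleton ℂ x) (B := innerSL ℂ x)
    (by rwa [ContinuousLinearMap.norm_toSpanSingleton]) (by rwa [innerSL_apply_norm])
  refine (congrArg IsSchurAgler (funext fun z => ?_)).mpr h
  ext
  have := hx (S z)
  simp only [ContinuousLinearMap.comp_apply, ContinuousLinearMap.toSpanSingleton_apply, one_smul]
  rw [innerSL_apply_apply, show tensorFun _ z = TensorPow.map n _ from rfl, this]
  simp

theorem mainTheorem5 (d : ℕ) :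
    (∀ (U : Type u) (V : Type v)
        [NormedAddCommGroup U] [InnerProductSpace ℂ U] [CompleteSpace U]
        [NormedAddCommGroup V] [InnerProductSpace ℂ V] [CompleteSpace V]
        (k : ℕ) (S : Fin k → (Fin d → ℂ) → U →L[ℂ] V),
        (∀ j, IsSchurAgler.{u, v, w} (S j)) →
          IsSchurAgler.{u, v, w} (tensorFun S) ∧ IsSchurAgler.{u, v, w} (wedgeFun S)) ∧
    (∀ (n : ℕ) (S : (Fin d → ℂ) → Matrix (Fin n) (Fin n) ℂ),
        IsMatrixSchurAgler.{w} S →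
          (∀ k, 1 ≤ k → k ≤ n → IsMatrixSchurAgler.{w} fun z => compoundMatrix k (S z)) ∧
          IsScalarSchurAgler.{w} fun z => (S z).det) :=
  ⟨fun _ _ _ _ _ _ _ _ _ _ hS => ⟨isSchurAgler_tensorFun hS, isSchurAgler_wedgeFun hS⟩,
    fun _ _ hS => ⟨fun k _ _ => isMatrixSchurAgler_compoundMatrix hS k,
      isScalarSchurAgler_det hS⟩⟩
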